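/- Throughout, $X$ is a set with at least two points. A quasi-metric on $X$ is a function $d:X\times X\to[0,\infty)$ for which there are constants $C_0,C_1\in(0,\infty)$ such that, for all $x,y,z\in X$: $d(x,y)=0$ iff $x=y$; $d(y,x)\le C_0\,d(x,y)$; and $d(x,y)\le C_1\max\{d(x,z),d(z,y)\}$. Put $C_d:=\sup\frac{d(x,y)}{\max\{d(x,z),d(z,y)\}}\in[1,\infty)$, the supremum being over $x,y,z\in X$ that are not all equal, and $B_d(x,r):=\{y\in X:d(x,y)<r\}$. A set $O\subseteq X$ is open in the topology $\tau_d$ if for each $x\in O$ there is $r>0$ with $B_d(x,r)\subseteq O$. Quasi-metrics $\rho,d$ are equivalent, $\rho\approx d$, if $\kappa^{-1}\rho\le d\le\kappa\rho$ for some $\kappa\in(0,\infty)$. The lower smoothness index is $$\mathrm{ind}(X,d):=\sup_{\rho\approx d}(\log_2 C_\rho)^{-1}\in(0,\infty]\qquad(1/0:=\infty),$$ the supremum being over all quasi-metrics $\rho$ on $X$ equivalent to $d$. For $\alpha\in(0,\infty)$ and $q\in(0,\infty]$, write $\alpha\preceq_q\mathrm{ind}(X,d)$ if $\alpha\le\mathrm{ind}(X,d)$,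 where equality is permitted only when $q=\infty$ and the supremum defining $\mathrm{ind}(X,d)$ is attained. A quasi-metric-measure space $(X,d,\mu)$ is a quasi-metric space $(X,d)$ with a nonnegative measure $\mu$ on a $\sigma$-algebra of subsets of $X$ that contains the Borel sets of $\tau_d$ and all balls $B_d(x,r)$, such that $0<\mu(B_d(x,r))<\infty$ for all $x\in X$, $r\in(0,\infty)$. For $c\in[1,\infty)$ and $\delta\in(0,\infty)$, $\mu$ is $(c,\delta)$-doubling if there is $C(\delta)\in[1,\infty)$ with $\mu(B_d(x,c\delta))\le C(\delta)\,\mu(B_d(x,\delta))$ for all $x\in X$. Let $\alpha,p\in(0,\infty)$ and $q\in(0,\infty]$. An $\alpha$-fractional gradient of a measurable $u:X\to\mathbb R$ is a sequence $\vec g=\{g_k\}_{k\in\mathbb Z}$ of measurable functions $g_k:X\to[0,\infty]$ for which there is a measurable set $E$ with $\mu(E)=0$ such that $|u(x)-u(y)|\le d(x,y)^\alpha\,(g_k(x)+g_k(y))$ for all $k\in\mathbb Z$ and all $x,y\in X\setminus E$ with $2^{-k-1}\le d(x,y)<2^{-k}$. Let $$\|u\|_{\dot M^\alpha_{p,q}}:=\inf_{\vec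 g}\Big\|\,\|\{g_k\}_{k\in\mathbb Z}\|_{\ell^q}\Big\|_{L^p(X,\mu)},\qquad \|u\|_{\dot N^\alpha_{p,q}}:=\inf_{\vec g}\Big\|\big\{\|g_k\|_{L^p(X,\mu)}\big\}_{k\in\mathbb Z}\Big\|_{\ell^q},$$ the infima being over all $\alpha$-fractional gradients $\vec g$ of $u$. The space $M^\alpha_{p,q}(X,d,\mu)$ (respectively $N^\alpha_{p,q}(X,d,\mu)$) consists of all measurable $u\in L^p(X,\mu)$ for which $\|u\|_{\dot M^\alpha_{p,q}}<\infty$ (respectively $\|u\|_{\dot N^\alpha_{p,q}}<\infty$), with the (quasi-)norm $\|u\|_{L^p(X,\mu)}+\|u\|_{\dot M^\alpha_{p,q}}$ (respectively $\|u\|_{L^p(X,\mu)}+\|u\|_{\dot N^\alpha_{p,q}}$). The embedding of such a space into $L^p(X,\mu)$ is compact if every sequence that is bounded in the space has a subsequence that converges in $L^p(X,\mu)$. Finally, $(X,d)$ is totally bounded if for every $r\in(0,\infty)$ it is a finite union of balls $B_d(x,r)$. **Theorem.** Let $(X,d,\mu)$ be a quasi-metric-measure space and suppose that there exists $\delta_0\in(0,\infty)$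 such that $\mu$ is $(C_d,\delta)$-doubling for every $\delta\in(0,\delta_0]$. Fix $\alpha,p\in(0,\infty)$ and $q\in(0,\infty]$, and suppose that $\alpha\preceq_q\mathrm{ind}(X,d)$. If either of the embeddings $$M^\alpha_{p,q}(X,d,\mu)\hookrightarrow L^p(X,\mu)\qquad\text{or}\qquad N^\alpha_{p,q}(X,d,\mu)\hookrightarrow L^p(X,\mu)$$ is compact, then $(X,d)$ is totally bounded. -/

import Mathlib

open MeasureTheory Filter Topology
open scoped ENNReal NNReal

namespace HajlaszEmbedding

/-- `d` is a quasi-metric on `X`. Spaces are required to have at least two points, which is imposed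
through `[Nontrivial X]` in the theorem. -/
structure IsQuasiMetric {X : Type*} (d : X → X → ℝ) : Prop where
  nonneg : ∀ x y, 0 ≤ d x y
  eq_zero_iff : ∀ x y, d x y = 0 ↔ x = y
  quasi_symm : ∃ C₀ : ℝ, 0 < C₀ ∧ ∀ x y, d y x ≤ C₀ * d x y
  quasi_triangle : ∃ C₁ : ℝ, 0 < C₁ ∧ ∀ x y z, d x y ≤ C₁ * max (d x z) (d z y)

/-- The optimal constant `C_d` in the quasi-triangle inequality: the supremum of
`d(x,y) / max{d(x,z), d(z,y)}` over all `x, y, z` that are not all equal. -/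
noncomputable def optConst {X : Type*} (d : X → X → ℝ) : ℝ :=
  sSup {t : ℝ | ∃ x y z : X, ¬ (x = y ∧ y = z) ∧ t = d x y / max (d x z) (d z y)}

/-- `ρ ≈ d`: the two functions are comparable up to a positive multiplicative constant. -/
def Equivalent {X : Type*} (ρ d : X → X → ℝ) : Prop :=
  ∃ κ : ℝ, 0 < κ ∧ ∀ x y, κ⁻¹ * ρ x y ≤ d x y ∧ d x y ≤ κ * ρ x y

/-- `(log₂ C_ρ)⁻¹ ∈ (0, ∞]`, with `1 / 0 = ∞` (recall that `C_ρ ≥ 1`). -/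
noncomputable def smoothness {X : Type*} (ρ : X → X → ℝ) : ℝ≥0∞ :=
  (ENNReal.ofReal (Real.logb 2 (optConst ρ)))⁻¹

/-- The lower smoothness index `ind(X, d)`. -/
noncomputable def lowerSmoothnessIndex {X : Type*} (d : X → X → ℝ) : ℝ≥0∞ :=
  ⨆ (ρ : X → X → ℝ) (_ : IsQuasiMetric ρ ∧ Equivalent ρ d), smoothness ρ

/-- `α ⪯_q ind(X, d)`: one has `α ≤ ind(X, d)`, and equality is only permitted when `q = ∞` and the
supremum defining the index is attained. -/
def PrecIndex {X : Type*} (α : ℝ) (q : ℝ≥0∞) (d : X → X → ℝ) : Prop :=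
  ENNReal.ofReal α ≤ lowerSmoothnessIndex d ∧
    (ENNReal.ofReal α = lowerSmoothnessIndex d →
      q = ∞ ∧ ∃ ρ : X → X → ℝ,
        IsQuasiMetric ρ ∧ Equivalent ρ d ∧ smoothness ρ = lowerSmoothnessIndex d)

/-- The ball `B_d(x, r) = {y : d(x, y) < r}`. -/
def qball {X : Type*} (d : X → X → ℝ) (x : X) (r : ℝ) : Set X :=
  {y | d x y < r}

/-- The topology `τ_d`: a set is open if it contains a ball around each of its points. -/
@[reducible] def quasiMetricTopology {X : Type*} (d : X → X → ℝ) : TopologicalSpace X where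
  IsOpen O := ∀ x ∈ O, ∃ r : ℝ, 0 < r ∧ qball d x r ⊆ O
  isOpen_univ := fun _ _ => ⟨1, one_pos, Set.subset_univ _⟩
  isOpen_inter := by
    rintro s t hs ht x ⟨hxs, hxt⟩
    obtain ⟨r₁, h₁, hr₁⟩ := hs x hxs
    obtain ⟨r₂, h₂, hr₂⟩ := ht x hxt
    refine ⟨min r₁ r₂, lt_min h₁ h₂, fun y hy => ?_⟩
    have hy' : d x y < min r₁ r₂ := hy
    exact ⟨hr₁ (hy'.trans_le (min_le_left _ _)), hr₂ (hy'.trans_le (min_le_right _ _))⟩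
  isOpen_sUnion := by
    intro S hS x hx
    obtain ⟨t, htS, hxt⟩ := hx
    obtain ⟨r, hr, hsub⟩ := hS t htS x hxt
    exact ⟨r, hr, fun y hy => ⟨t, htS, hsub hy⟩⟩

/-- `(X, d, μ)` is a quasi-metric-measure space: the domain of `μ` is a σ-algebra which contains the
Borel sets of `τ_d` and all `d`-balls, and all balls have positive and finite measure. -/
structure IsQuasiMetricMeasureSpace {X : Type*} [m : MeasurableSpace X] (d : X → X → ℝ)
    (μ : Measure X) : Prop where
  isQuasiMetric : IsQuasiMetric d
  borel_le : @borel X (quasiMetricTopology d) ≤ m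
  measurableSet_ball : ∀ (x : X) (r : ℝ), 0 < r → MeasurableSet (qball d x r)
  measure_ball_pos : ∀ (x : X) (r : ℝ), 0 < r → 0 < μ (qball d x r)
  measure_ball_lt_top : ∀ (x : X) (r : ℝ), 0 < r → μ (qball d x r) < ∞

/-- `μ` is `(c, δ)`-doubling with respect to `d`. -/
def IsDoublingAt {X : Type*} [MeasurableSpace X] (d : X → X → ℝ) (μ : Measure X)
    (c δ : ℝ) : Prop :=
  ∃ C : ℝ≥0, 1 ≤ C ∧ ∀ x : X, μ (qball d x (c * δ)) ≤ (C : ℝ≥0∞) * μ (qball d x δ)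

/-- `(X, d)` is totally bounded: for every `r > 0` it is covered by finitely many balls of
radius `r`. -/
def IsTotallyBounded {X : Type*} (d : X → X → ℝ) : Prop :=
  ∀ r : ℝ, 0 < r → ∃ s : Set X, s.Finite ∧ ⋃ x ∈ s, qball d x r = Set.univ

/-- The `α`-fractional gradients of `u`: sequences `(g_k)`, `k ∈ ℤ`, of nonnegative measurable
functions such that, off a measurable null set,
`|u(x) - u(y)| ≤ d(x,y)^α (g_k(x) + g_k(y))` whenever `2^(-k-1) ≤ d(x,y) < 2^(-k)`. -/
def fractionalGradients {X : Type*} [MeasurableSpace X] (d : X → X → ℝ) (μ : Measure X)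
    (α : ℝ) (u : X → ℝ) : Set (ℤ → X → ℝ≥0∞) :=
  {g | (∀ k, Measurable (g k)) ∧ ∃ E : Set X, MeasurableSet E ∧ μ E = 0 ∧
    ∀ (k : ℤ) (x y : X), x ∉ E → y ∉ E →
      (2 : ℝ) ^ (-k - 1) ≤ d x y → d x y < (2 : ℝ) ^ (-k) →
        ENNReal.ofReal |u x - u y| ≤ ENNReal.ofReal (d x y ^ α) * (g k x + g k y)}

/-- The `ℓ^q(ℤ)` (quasi-)norm of a sequence of values in `[0, ∞]`. -/
noncomputable def seqNorm (q : ℝ≥0∞) (a : ℤ → ℝ≥0∞) : ℝ≥0∞ :=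
  if q = ∞ then ⨆ k, a k else (∑' k, a k ^ q.toReal) ^ (1 / q.toReal)

/-- The `L^p(X, μ)` (quasi-)norm, `p ∈ (0, ∞)`, of a function with values in `[0, ∞]`. -/
noncomputable def intNorm {X : Type*} [MeasurableSpace X] (μ : Measure X) (p : ℝ)
    (f : X → ℝ≥0∞) : ℝ≥0∞ :=
  (∫⁻ x, f x ^ p ∂μ) ^ (1 / p)

/-- The homogeneous Hajłasz–Triebel–Lizorkin semi-norm: the infimum of the `L^p(X; ℓ^q)` norms of
the fractional gradients. -/
noncomputable def homTriebelLizorkin {X : Type*} [MeasurableSpace X] (d : X → X → ℝ)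
    (μ : Measure X) (α p : ℝ) (q : ℝ≥0∞) (u : X → ℝ) : ℝ≥0∞ :=
  ⨅ g ∈ fractionalGradients d μ α u, intNorm μ p (fun x => seqNorm q (fun k => g k x))

/-- The homogeneous Hajłasz–Besov semi-norm: the infimum of the `ℓ^q(L^p)` norms of the fractional
gradients. -/
noncomputable def homBesov {X : Type*} [MeasurableSpace X] (d : X → X → ℝ)
    (μ : Measure X) (α p : ℝ) (q : ℝ≥0∞) (u : X → ℝ) : ℝ≥0∞ :=
  ⨅ g ∈ fractionalGradients d μ α u, seqNorm q (fun k => intNorm μ p (g k))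

/-- The inhomogeneous space attached to a semi-norm `S`: all measurable `u : X → ℝ` in `L^p` with
`S u < ∞`. -/
def inhomSpace {X : Type*} [MeasurableSpace X] (μ : Measure X) (p : ℝ)
    (S : (X → ℝ) → ℝ≥0∞) : Set (X → ℝ) :=
  {u | Measurable u ∧ MemLp u (ENNReal.ofReal p) μ ∧ S u < ∞}

/-- The (quasi-)norm `‖u‖_{L^p} + S u` of the inhomogeneous space attached to `S`. -/
noncomputable def inhomNorm {X : Type*} [MeasurableSpace X] (μ : Measure X) (p : ℝ)
    (S : (X → ℝ) → ℝ≥0∞) (u : X → ℝ) : ℝ≥0∞ :=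
  eLpNorm u (ENNReal.ofReal p) μ + S u

/-- The inhomogeneous space attached to `S` embeds compactly into `L^p(X, μ)`: every sequence in the
space that is bounded in its (quasi-)norm has a subsequence that converges in `L^p(X, μ)`. (The
inclusion into `L^p` is part of the definition of the space, and is norm-decreasing.) -/
def CompactlyEmbedded {X : Type*} [MeasurableSpace X] (μ : Measure X) (p : ℝ)
    (S : (X → ℝ) → ℝ≥0∞) : Prop :=
  ∀ u : ℕ → X → ℝ, (∀ n, u n ∈ inhomSpace μ p S) →
    (∃ R : ℝ≥0, ∀ n, inhomNorm μ p S (u n) ≤ R) →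
      ∃ (v : X → ℝ) (φ : ℕ → ℕ), MemLp v (ENNReal.ofReal p) μ ∧ StrictMono φ ∧
        Tendsto (fun n => eLpNorm (u (φ n) - v) (ENNReal.ofReal p) μ) atTop (𝓝 0)

/-- The embedding `M^α_{p,q}(X, d, μ) ↪ L^p(X, μ)` is compact. -/
def TriebelLizorkinCompact {X : Type*} [MeasurableSpace X] (d : X → X → ℝ) (μ : Measure X)
    (α p : ℝ) (q : ℝ≥0∞) : Prop :=
  CompactlyEmbedded μ p (homTriebelLizorkin d μ α p q)

/-- The embedding `N^α_{p,q}(X, d, μ) ↪ L^p(X, μ)` is compact. -/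
def BesovCompact {X : Type*} [MeasurableSpace X] (d : X → X → ℝ) (μ : Measure X)
    (α p : ℝ) (q : ℝ≥0∞) : Prop :=
  CompactlyEmbedded μ p (homBesov d μ α p q)

end HajlaszEmbedding

namespace HajlaszEmbedding

/-! If `X` is not totally bounded at scale `r`, it contains an infinite `r`-separated sequence, and
balls `B_n` of a fixed small radius `s` about its points are pairwise disjoint
(`exists_disjoint_qball`). Each ball carries the function `μ(B_n)^(-1/p) * b_n`, where `b_n` is a
bump, Hölder of order `β ≥ α` with a constant independent of `n`. These functions are bounded in
both spaces. Their mutual `L^p` distances are bounded below, because `b_n = 1` on a smaller ball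
carrying a fixed fraction of the measure of `B_n`; so no subsequence converges
(`not_compactlyEmbedded_of_bumps`).

The bumps come from Frink's lemma: `α ⪯_q ind(X,d)` gives `β` with `d ^ β` comparable to a
pseudo-metric, and a cutoff of its distance function is Hölder. Local doubling compares the two
balls if `C_d > 1`. If `C_d = 1` doubling says nothing, but indicators of balls are already Hölder
(`exists_isBump_of_optConst_eq_one`). -/

/-! ### Frink's metrization lemma with the sharp constant -/

/-- Weight 2 on the two end links, instead of 4, is what closes the induction: the chain is cut into
two overlapping subchains whose common link is an end link of both, so its weights add up to 4. -/
theorem frink_chain_strong {X : Type*} {e : X → X → ℝ} (h0 : ∀ x y, 0 ≤ e x y)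
    (h2 : ∀ x y z, e x y ≤ 2 * max (e x z) (e z y)) (n : ℕ) (x : ℕ → X) :
    e (x 0) (x (n + 2)) ≤ 4 * ∑ k ∈ Finset.range (n + 2), e (x k) (x (k + 1))
      - 2 * e (x 0) (x 1) - 2 * e (x (n + 1)) (x (n + 2)) := by
  induction n using Nat.strong_induction_on generalizing x with
  | _ n ih =>
    classical
    have hends : e (x 0) (x 1) + e (x (n + 1)) (x (n + 2)) ≤
        ∑ k ∈ Finset.range (n + 2), e (x k) (x (k + 1)) := by
      rw [Finset.sum_range_succ, Finset.sum_range_succ']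
      have : 0 ≤ ∑ k ∈ Finset.range n, e (x (k + 1)) (x (k + 1 + 1)) :=
        Finset.sum_nonneg fun _ _ => h0 _ _
      simp only [zero_add]
      linarith
    have hf := h0 (x 0) (x 1)
    have hl := h0 (x (n + 1)) (x (n + 2))
    have hN := h0 (x 0) (x (n + 2))
    -- At the last `r` with `P r`, failure of `P (r + 1)` bounds the total by `2 * e (x 0) (x (r +
    -- 1))`. Averaging the two bounds leaves the subchains from `0` to `r + 1` and from `r` to `n +
    -- 2`.
    let P : ℕ → Prop := fun r => e (x 0) (x (n + 2)) ≤ 2 * e (x r) (x (n + 2))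
    have hP0 : P 0 := by simp only [P]; linarith
    obtain ⟨r, hr, hPr, hmax⟩ : ∃ r ≤ n + 1, P r ∧ ∀ k, r < k → k ≤ n + 1 → ¬ P k :=
      ⟨Nat.findGreatest P (n + 1), Nat.findGreatest_le _,
        Nat.findGreatest_spec (Nat.zero_le _) hP0,
        fun _ => Nat.findGreatest_is_greatest⟩
    simp only [P] at hPr hmax
    rcases hr.lt_or_eq with hlt | rfl
    · have hnot := hmax (r + 1) (Nat.lt_succ_self r) hlt
      have hle : e (x 0) (x (n + 2)) ≤ 2 * e (x 0) (x (r + 1)) := by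
        have := h2 (x 0) (x (n + 2)) (x (r + 1))
        rcases le_total (e (x 0) (x (r + 1))) (e (x (r + 1)) (x (n + 2))) with h | h
        · rw [max_eq_right h] at this; exact absurd this hnot
        · rwa [max_eq_left h] at this
      rcases r with _ | m
      · simp only [zero_add] at hle
        linarith
      · obtain ⟨j, rfl⟩ : ∃ j, n = m + 1 + j := ⟨n - (m + 1), by omega⟩
        have i1 := ih m (by omega) x
        have i2 := ih j (by omega) (fun k => x (m + 1 + k))
        have hsum : ∑ k ∈ Finset.range (m + 1 + j + 2), e (x k) (x (k + 1)) =
            ∑ k ∈ Finset.range (m + 1), e (x k) (x (k + 1)) +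
            ∑ k ∈ Finset.range (j + 2), e (x (m + 1 + k)) (x (m + 1 + (k + 1))) := by
          rw [add_assoc (m + 1) j 2, Finset.sum_range_add]
          rfl
        rw [Finset.sum_range_succ] at i1
        simp only [add_zero] at i2
        have e1 : m + 1 + (j + 2) = m + 1 + j + 2 := by ring
        have e2 : m + 1 + (j + 1) = m + 1 + j + 1 := by ring
        rw [e1, e2] at i2
        have e3 : m + 1 + 1 = m + 2 := rfl
        rw [e3] at i1 i2 hle
        rw [hsum]
        linarith
    · linarith

theorem frink_chain {X : Type*} {e : X → X → ℝ} (h0 : ∀ x y, 0 ≤ e x y)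
    (h2 : ∀ x y z, e x y ≤ 2 * max (e x z) (e z y)) (n : ℕ) (x : ℕ → X) :
    e (x 0) (x (n + 1)) ≤ 4 * ∑ k ∈ Finset.range (n + 1), e (x k) (x (k + 1)) := by
  rcases n with _ | n
  · have := h0 (x 0) (x 1)
    simp only [zero_add, Finset.sum_range_one]
    linarith
  · have := frink_chain_strong h0 h2 n x
    have h3 := h0 (x 0) (x 1)
    have h4 := h0 (x (n + 1)) (x (n + 2))
    have e3 : n + 1 + 1 = n + 2 := rfl
    rw [e3]
    linarith

theorem sum_zipWith_cons_append {X M : Type*} [AddCommMonoid M] (f : X → X → M) (l : List X)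
    (a b : X) :
    ((a :: l).zipWith f (l ++ [b])).sum = ∑ k ∈ Finset.range (l.length + 1),
      f ((a :: (l ++ [b])).getD k b) ((a :: (l ++ [b])).getD (k + 1) b) := by
  induction l generalizing a with
  | nil => simp
  | cons c l ih =>
    rw [List.length_cons, Finset.sum_range_succ', List.cons_append, List.zipWith_cons_cons,
      List.sum_cons, ih c, add_comm]
    rfl

/-- Frink's lemma: a symmetric function with `e x y ≤ 2 * max (e x z) (e z y)` that vanishes on the
diagonal is comparable, with constant `4`, to a pseudo-metric. -/
theorem exists_pseudoMetric_of_le_two_mul_max {X : Type*} {e : X → X → ℝ}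
    (h0 : ∀ x y, 0 ≤ e x y) (hself : ∀ x, e x x = 0) (hsymm : ∀ x y, e x y = e y x)
    (h2 : ∀ x y z, e x y ≤ 2 * max (e x z) (e z y)) :
    ∃ m : PseudoMetricSpace X, ∀ x y, m.dist x y ≤ e x y ∧ e x y ≤ 4 * m.dist x y := by
  let f : X → X → ℝ≥0 := fun x y => ⟨e x y, h0 x y⟩
  have hf : ∀ x y, (f x y : ℝ) = e x y := fun _ _ => rfl
  have fself : ∀ x, f x x = 0 := fun x => NNReal.eq (hself x)
  have fsymm : ∀ x y, f x y = f y x := fun x y => NNReal.eq (hsymm x y)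
  refine ⟨PseudoMetricSpace.ofPreNNDist f fself fsymm, fun x y =>
    ⟨PseudoMetricSpace.dist_ofPreNNDist_le f fself fsymm x y, ?_⟩⟩
  -- The distance of `ofPreNNDist` is the infimum of chain sums, so a bound valid for every chain
  -- passes to it.
  have key : f x y ≤ 4 * ⨅ l : List X, ((x :: l).zipWith f (l ++ [y])).sum := by
    rw [NNReal.mul_iInf]
    refine le_ciInf fun l => ?_
    rw [sum_zipWith_cons_append, ← NNReal.coe_le_coe]
    have := frink_chain h0 h2 l.length fun k => (x :: (l ++ [y])).getD k y
    simp only [List.getD_cons_zero, List.getD_cons_succ] at this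
    push_cast
    simpa [hf] using this
  exact_mod_cast key

/-! ### Quasi-metrics -/

theorem IsQuasiMetric.self {X : Type*} {d : X → X → ℝ} (hd : IsQuasiMetric d) (x : X) :
    d x x = 0 := (hd.eq_zero_iff x x).2 rfl

theorem IsQuasiMetric.max_pos {X : Type*} {d : X → X → ℝ} (hd : IsQuasiMetric d) {x y z : X}
    (h : ¬ (x = y ∧ y = z)) : 0 < max (d x z) (d z y) := by
  by_contra hle
  push Not at hle
  have h1 : x = z := (hd.eq_zero_iff x z).1
    (le_antisymm ((le_max_left _ _).trans hle) (hd.nonneg _ _))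
  have h2 : z = y := (hd.eq_zero_iff z y).1
    (le_antisymm ((le_max_right _ _).trans hle) (hd.nonneg _ _))
  exact h ⟨h1.trans h2, h2.symm⟩

theorem IsQuasiMetric.bddAbove {X : Type*} {d : X → X → ℝ} (hd : IsQuasiMetric d) :
    BddAbove {t : ℝ | ∃ x y z : X, ¬ (x = y ∧ y = z) ∧ t = d x y / max (d x z) (d z y)} := by
  obtain ⟨C, hC, h⟩ := hd.quasi_triangle
  refine ⟨C, ?_⟩
  rintro t ⟨x, y, z, hne, rfl⟩
  exact (div_le_iff₀ (hd.max_pos hne)).2 (h x y z)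

theorem IsQuasiMetric.le_optConst_mul {X : Type*} {d : X → X → ℝ} (hd : IsQuasiMetric d)
    (x y z : X) : d x y ≤ optConst d * max (d x z) (d z y) := by
  by_cases h : x = y ∧ y = z
  · obtain ⟨rfl, rfl⟩ := h
    simp [hd.self]
  · exact (div_le_iff₀ (hd.max_pos h)).1 (le_csSup hd.bddAbove ⟨x, y, z, h, rfl⟩)

theorem IsQuasiMetric.one_le_optConst {X : Type*} [Nontrivial X] {d : X → X → ℝ}
    (hd : IsQuasiMetric d) : 1 ≤ optConst d := by
  obtain ⟨x, y, hxy⟩ := exists_pair_ne X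
  have hpos : 0 < d x y := (hd.nonneg x y).lt_of_ne fun h => hxy ((hd.eq_zero_iff x y).1 h.symm)
  refine le_csSup hd.bddAbove ⟨x, y, y, fun h => hxy h.1, ?_⟩
  rw [hd.self, max_eq_left hpos.le, div_self hpos.ne']

theorem IsQuasiMetric.exists_symm_const {X : Type*} {d : X → X → ℝ} (hd : IsQuasiMetric d) :
    ∃ C : ℝ, 1 ≤ C ∧ ∀ x y, d y x ≤ C * d x y := by
  obtain ⟨C, -, h⟩ := hd.quasi_symm
  exact ⟨max 1 C, le_max_left _ _, fun x y =>
    (h x y).trans (mul_le_mul_of_nonneg_right (le_max_right _ _) (hd.nonneg _ _))⟩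

/-- If `C_ρ ^ β ≤ 2`, then `d ^ β` is comparable to a pseudo-metric whenever `d ≈ ρ`. -/
theorem exists_pseudoMetric_rpow {X : Type*} [Nontrivial X] {ρ d : X → X → ℝ}
    (hρ : IsQuasiMetric ρ) (hd : IsQuasiMetric d) (hequiv : Equivalent ρ d) {β : ℝ} (hβ : 0 < β)
    (hC : optConst ρ ^ β ≤ 2) :
    ∃ (m : PseudoMetricSpace X) (a b : ℝ), 0 < a ∧ 0 < b ∧
      ∀ x y, a * d x y ^ β ≤ m.dist x y ∧ m.dist x y ≤ b * d x y ^ β := by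
  have h1 := hρ.one_le_optConst
  obtain ⟨C₀, hC₀, hs⟩ := hρ.exists_symm_const
  obtain ⟨κ, hκ, hk⟩ := hequiv
  -- Symmetrizing by the maximum keeps the triangle constant `optConst ρ`.
  set σ : X → X → ℝ := fun x y => max (ρ x y) (ρ y x) with hσ
  have σ0 : ∀ x y, 0 ≤ σ x y := fun x y => le_max_of_le_left (hρ.nonneg x y)
  have σtri : ∀ x y z, σ x y ≤ optConst ρ * max (σ x z) (σ z y) := by
    intro x y z
    refine max_le ?_ ?_
    · refine (hρ.le_optConst_mul x y z).trans (mul_le_mul_of_nonneg_left ?_ (by linarith))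
      exact max_le_max (le_max_left _ _) (le_max_left _ _)
    · refine (hρ.le_optConst_mul y x z).trans (mul_le_mul_of_nonneg_left ?_ (by linarith))
      rw [max_comm]
      exact max_le_max (le_max_right _ _) (le_max_right _ _)
  have σle : ∀ x y, σ x y ≤ C₀ * κ * d x y := by
    intro x y
    have h3 : ρ x y ≤ κ * d x y := by
      have := (hk x y).1
      rwa [inv_mul_le_iff₀ hκ] at this
    have h4 : C₀ * ρ x y ≤ C₀ * (κ * d x y) := mul_le_mul_of_nonneg_left h3 (by linarith)
    have h5 : ρ x y ≤ C₀ * ρ x y := le_mul_of_one_le_left (hρ.nonneg x y) hC₀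
    exact max_le (by linarith) ((hs x y).trans (by linarith))
  have leσ : ∀ x y, κ⁻¹ * d x y ≤ σ x y := by
    intro x y
    rw [inv_mul_le_iff₀ hκ]
    exact (hk x y).2.trans (mul_le_mul_of_nonneg_left (le_max_left _ _) hκ.le)
  obtain ⟨m, hm⟩ := exists_pseudoMetric_of_le_two_mul_max (e := fun x y => σ x y ^ β)
    (fun x y => Real.rpow_nonneg (σ0 x y) β)
    (fun x => by simp [hσ, hρ.self, Real.zero_rpow hβ.ne'])
    (fun x y => by simp [hσ, max_comm])
    (fun x y z => by
      -- Truncating at `0` makes the power monotone on all of `ℝ`, so that it commutes with `max`.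
      have hmono : Monotone fun t : ℝ => (max t 0) ^ β := fun s t hst =>
        Real.rpow_le_rpow (le_max_right _ _) (max_le_max_right _ hst) hβ.le
      have hmax := hmono.map_max (a := σ x z) (b := σ z y)
      simp only [max_eq_left (σ0 _ _), max_eq_left (le_max_of_le_left (σ0 x z))] at hmax
      rw [← hmax]
      calc σ x y ^ β ≤ (optConst ρ * max (σ x z) (σ z y)) ^ β :=
            Real.rpow_le_rpow (σ0 _ _) (σtri x y z) hβ.le
        _ = optConst ρ ^ β * max (σ x z) (σ z y) ^ β :=
            Real.mul_rpow (by linarith) (le_max_of_le_left (σ0 _ _))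
        _ ≤ 2 * max (σ x z) (σ z y) ^ β :=
            mul_le_mul_of_nonneg_right hC (Real.rpow_nonneg (le_max_of_le_left (σ0 _ _)) _))
  refine ⟨m, κ⁻¹ ^ β / 4, (C₀ * κ) ^ β, by positivity, by positivity, fun x y => ⟨?_, ?_⟩⟩
  · have h3 : (κ⁻¹ * d x y) ^ β ≤ σ x y ^ β :=
      Real.rpow_le_rpow (mul_nonneg (by positivity) (hd.nonneg _ _)) (leσ x y) hβ.le
    rw [Real.mul_rpow (by positivity) (hd.nonneg _ _)] at h3
    linarith [(hm x y).2]
  · rw [← Real.mul_rpow (by positivity) (hd.nonneg _ _)]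
    exact (hm x y).1.trans (Real.rpow_le_rpow (σ0 _ _) (σle x y) hβ.le)

theorem optConst_rpow_le_two {X : Type*} [Nontrivial X] {ρ : X → X → ℝ} (hρ : IsQuasiMetric ρ)
    {β : ℝ} (hβ : 0 < β) (h : ENNReal.ofReal β ≤ smoothness ρ) : optConst ρ ^ β ≤ 2 := by
  have h1 := hρ.one_le_optConst
  have hl : 0 ≤ Real.logb 2 (optConst ρ) := Real.logb_nonneg one_lt_two h1
  -- The product form includes `optConst ρ = 1`, where the smoothness is `∞`.
  have h2 : Real.logb 2 (optConst ρ) * β ≤ 1 := by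
    rw [smoothness, ENNReal.le_inv_iff_mul_le, ← ENNReal.ofReal_mul hβ.le,
      ENNReal.ofReal_le_one] at h
    linarith
  calc optConst ρ ^ β = ((2 : ℝ) ^ Real.logb 2 (optConst ρ)) ^ β := by
        rw [Real.rpow_logb two_pos (by norm_num) (by linarith)]
    _ = (2 : ℝ) ^ (Real.logb 2 (optConst ρ) * β) := by rw [Real.rpow_mul two_pos.le]
    _ ≤ (2 : ℝ) ^ (1 : ℝ) := Real.rpow_le_rpow_of_exponent_le one_le_two h2
    _ = 2 := Real.rpow_one 2

/-- The condition `α ⪯_q ind(X, d)` provides an exponent `β ≥ α`, with `β > α` if `q < ∞`, for which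
`d ^ β` is comparable to a pseudo-metric. -/
theorem PrecIndex.exists_pseudoMetric {X : Type*} [Nontrivial X] {α : ℝ} {q : ℝ≥0∞}
    {d : X → X → ℝ} (h : PrecIndex α q d) (hd : IsQuasiMetric d) (hα : 0 < α) :
    ∃ β : ℝ, α ≤ β ∧ (q = ∞ ∨ α < β) ∧ ∃ (m : PseudoMetricSpace X) (a b : ℝ), 0 < a ∧ 0 < b ∧
      ∀ x y, a * d x y ^ β ≤ m.dist x y ∧ m.dist x y ≤ b * d x y ^ β := by
  rcases h.1.lt_or_eq with hlt | heq
  · simp only [lowerSmoothnessIndex, lt_iSup_iff] at hlt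
    obtain ⟨ρ, ⟨hρ, hequiv⟩, hlt⟩ := hlt
    obtain ⟨β, -, h1, h2⟩ := ENNReal.lt_iff_exists_real_btwn.1 hlt
    have hαβ : α < β := (ENNReal.ofReal_lt_ofReal_iff'.1 h1).1
    exact ⟨β, hαβ.le, .inr hαβ, exists_pseudoMetric_rpow hρ hd hequiv (hα.trans hαβ)
      (optConst_rpow_le_two hρ (hα.trans hαβ) h2.le)⟩
  · obtain ⟨hq, ρ, hρ, hequiv, hs⟩ := h.2 heq
    exact ⟨α, le_rfl, .inl hq, exists_pseudoMetric_rpow hρ hd hequiv hα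
      (optConst_rpow_le_two hρ hα (by rw [hs]; exact h.1))⟩

end HajlaszEmbedding

namespace HajlaszEmbedding

/-! ### Bump functions -/

/-- Every radius used is at most `s ≤ δ₀`, so local doubling suffices; `K` depends on `j` but not on
the centre. -/
theorem IsDoublingAt.iterate {X : Type*} [MeasurableSpace X] {d : X → X → ℝ} {μ : Measure X}
    {c δ₀ s : ℝ} (hc : 1 ≤ c) (hdoub : ∀ δ : ℝ, 0 < δ → δ ≤ δ₀ → IsDoublingAt d μ c δ)
    (hs : 0 < s) (hsδ : s ≤ δ₀) (j : ℕ) :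
    ∃ K : ℝ≥0, ∀ x, μ (qball d x s) ≤ K * μ (qball d x (s / c ^ j)) := by
  induction j with
  | zero => exact ⟨1, fun x => by simp⟩
  | succ j ih =>
    obtain ⟨K, h⟩ := ih
    have hpos : 0 < s / c ^ (j + 1) := by positivity
    obtain ⟨C, -, hx⟩ := hdoub (s / c ^ (j + 1)) hpos
      ((div_le_self hs.le (one_le_pow₀ hc)).trans hsδ)
    refine ⟨K * C, fun x => (h x).trans ?_⟩
    have e : c * (s / c ^ (j + 1)) = s / c ^ j := by
      have : c ≠ 0 := by positivity
      field_simp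
      ring
    rw [ENNReal.coe_mul, mul_assoc]
    gcongr
    rw [← e]
    exact hx x

/-- A bump function at `x`, supported in the ball of radius `s`, equal to `1` on the ball of
radius `s'`, and Hölder continuous of order `β` with constant `L`. -/
structure IsBump {X : Type*} (d : X → X → ℝ) (β L s s' : ℝ) (x : X) (b : X → ℝ) : Prop where
  nonneg : ∀ y, 0 ≤ b y
  le_one : ∀ y, b y ≤ 1
  eq_zero : ∀ y, y ∉ qball d x s → b y = 0
  eq_one : ∀ y ∈ qball d x s', b y = 1
  holder : ∀ y z, |b y - b z| ≤ L * d y z ^ β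

theorem IsBump.mono {X : Type*} {d : X → X → ℝ} {β L s s' s'' : ℝ} {x : X} {b : X → ℝ}
    (hb : IsBump d β L s s' x b) (h : s'' ≤ s') : IsBump d β L s s'' x b :=
  ⟨hb.nonneg, hb.le_one, hb.eq_zero, fun y hy => hb.eq_one y (lt_of_lt_of_le hy h), hb.holder⟩

/-- The Hölder bound makes preimages of open sets open in `τ_d`; no openness of balls is needed. -/
theorem IsBump.measurable {X : Type*} [m : MeasurableSpace X] {d : X → X → ℝ} {β L s s' : ℝ}
    {x : X} {b : X → ℝ} (hb : IsBump d β L s s' x b) (hd : IsQuasiMetric d)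
    (hm : @borel X (quasiMetricTopology d) ≤ m) (hβ : 0 < β) (hL : 0 < L) : Measurable b := by
  refine measurable_of_isOpen fun O hO => hm _ (MeasurableSpace.measurableSet_generateFrom ?_)
  intro y hy
  obtain ⟨ε, hε, hball⟩ := Metric.isOpen_iff.1 hO (b y) hy
  refine ⟨(ε / L) ^ β⁻¹, by positivity, fun z hz => hball ?_⟩
  have hz' : d y z < (ε / L) ^ β⁻¹ := hz
  have h1 : d y z ^ β < ε / L := by
    have := Real.rpow_lt_rpow (hd.nonneg y z) hz' hβ
    rwa [Real.rpow_inv_rpow (by positivity) hβ.ne'] at this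
  rw [Metric.mem_ball, dist_comm, Real.dist_eq]
  calc |b y - b z| ≤ L * d y z ^ β := hb.holder y z
    _ < L * (ε / L) := by gcongr
    _ = ε := by field_simp

theorem exists_isBump_of_pseudoMetric {X : Type*} {d : X → X → ℝ} (hd : IsQuasiMetric d)
    (m : PseudoMetricSpace X) {a b β s : ℝ} (ha : 0 < a) (hb : 0 < b) (hβ : 0 < β) (hs : 0 < s)
    (h : ∀ x y, a * d x y ^ β ≤ m.dist x y ∧ m.dist x y ≤ b * d x y ^ β) :
    ∃ L s' : ℝ, 0 < L ∧ 0 < s' ∧ ∀ x, ∃ u, IsBump d β L s s' x u := by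
  -- The cutoff is `1` where the pseudo-distance is at most `τ` and `0` where it is at least `2 *
  -- τ`; the latter holds off the `s`-ball, and `(τ / b) ^ β⁻¹` is the radius that ensures the
  -- former.
  set τ : ℝ := a * s ^ β / 2 with hτ
  have hτ0 : 0 < τ := by positivity
  refine ⟨b / τ, (τ / b) ^ β⁻¹, by positivity, by positivity, fun x =>
    ⟨fun y => max 0 (min 1 (2 - m.dist x y / τ)), ⟨fun y => le_max_left _ _,
      fun y => max_le zero_le_one (min_le_left _ _), fun y hy => ?_, fun y hy => ?_,
      fun y z => ?_⟩⟩⟩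
  · have h1 : s ≤ d x y := not_lt.1 hy
    have h2 : a * s ^ β ≤ m.dist x y :=
      (mul_le_mul_of_nonneg_left (Real.rpow_le_rpow hs.le h1 hβ.le) ha.le).trans (h x y).1
    have h3 : 2 ≤ m.dist x y / τ := by rw [le_div_iff₀ hτ0, hτ]; linarith
    exact max_eq_left ((min_le_right _ _).trans (by linarith))
  · have h1 : d x y < (τ / b) ^ β⁻¹ := hy
    have h2 : d x y ^ β < τ / b := by
      have := Real.rpow_lt_rpow (hd.nonneg x y) h1 hβ
      rwa [Real.rpow_inv_rpow (by positivity) hβ.ne'] at this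
    rw [lt_div_iff₀ hb, mul_comm] at h2
    have h3 : m.dist x y / τ ≤ 1 := by
      rw [div_le_one hτ0]
      exact (h x y).2.trans h2.le
    change max 0 (min 1 (2 - m.dist x y / τ)) = 1
    rw [min_eq_left (by linarith), max_eq_right zero_le_one]
  · have htri : |m.dist x y - m.dist x z| ≤ m.dist y z := by
      have := m.dist_triangle x y z
      have h2 := m.dist_triangle x z y
      rw [m.dist_comm z y] at h2
      rw [abs_le]
      constructor <;> linarith
    have h1 := abs_max_sub_max_le_max (0 : ℝ) (min 1 (2 - m.dist x y / τ)) 0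
      (min 1 (2 - m.dist x z / τ))
    have h2 := abs_min_sub_min_le_max (1 : ℝ) (2 - m.dist x y / τ) 1 (2 - m.dist x z / τ)
    simp only [sub_self, abs_zero] at h1 h2
    rw [max_eq_right (a := (0 : ℝ)) (abs_nonneg _)] at h1 h2
    refine h1.trans (h2.trans ?_)
    have e : 2 - m.dist x y / τ - (2 - m.dist x z / τ) = -((m.dist x y - m.dist x z) / τ) := by ring
    rw [e, abs_neg, abs_div, abs_of_pos hτ0, div_mul_eq_mul_div]
    gcongr
    exact htri.trans (h y z).2

/-- In this ultrametric-like case a point inside a ball and one outside are at distance at least `s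
/ C₀`, so the jump of the indicator is harmless and `s' = s` is allowed. -/
theorem exists_isBump_of_optConst_eq_one {X : Type*} {d : X → X → ℝ} (hd : IsQuasiMetric d)
    (h1 : optConst d = 1) {β s : ℝ} (hβ : 0 < β) (hs : 0 < s) :
    ∃ L : ℝ, 0 < L ∧ ∀ x, ∃ u, IsBump d β L s s x u := by
  classical
  obtain ⟨C₀, hC₀, hsym⟩ := hd.exists_symm_const
  have hC₀' : 0 < C₀ := by linarith
  have hsep : ∀ x y z, y ∈ qball d x s → z ∉ qball d x s → s ≤ d y z := by
    intro x y z hy hz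
    have hy' : d x y < s := hy
    have hz' : s ≤ d x z := not_lt.1 hz
    have := hd.le_optConst_mul x z y
    rw [h1, one_mul] at this
    exact (le_max_iff.1 (hz'.trans this)).resolve_left (not_le.2 hy')
  have hlarge : ∀ y z, s ≤ C₀ * d y z → 1 ≤ (C₀ / s) ^ β * d y z ^ β := by
    intro y z h
    rw [← Real.mul_rpow (by positivity) (hd.nonneg _ _)]
    refine Real.one_le_rpow ?_ hβ.le
    rw [div_mul_eq_mul_div, le_div_iff₀ hs]
    linarith
  refine ⟨(C₀ / s) ^ β, by positivity, fun x => ⟨(qball d x s).indicator 1,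
    ⟨fun y => Set.indicator_nonneg (fun _ _ => zero_le_one) y,
      fun y => Set.indicator_le_self' (fun _ _ => zero_le_one) y,
      fun y hy => Set.indicator_of_notMem hy _, fun y hy => Set.indicator_of_mem hy _,
      fun y z => ?_⟩⟩⟩
  have hR : 0 ≤ (C₀ / s) ^ β * d y z ^ β :=
    mul_nonneg (by positivity) (Real.rpow_nonneg (hd.nonneg _ _) _)
  by_cases hy : y ∈ qball d x s <;> by_cases hz : z ∈ qball d x s
  · simpa [hy, hz] using hR
  · simpa [hy, hz] using hlarge y z
      ((hsep x y z hy hz).trans (le_mul_of_one_le_left (hd.nonneg _ _) hC₀))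
  · simpa [hy, hz] using hlarge y z ((hsep x z y hz hy).trans (hsym y z))
  · simpa [hy, hz] using hR

/-- Under the local doubling condition there are bump functions on all balls of a small radius `s`,
equal to `1` on balls of comparable measure. -/
theorem exists_isBump_of_doubling {X : Type*} [Nontrivial X] [MeasurableSpace X] {d : X → X → ℝ}
    {μ : Measure X} (hd : IsQuasiMetric d) {δ₀ : ℝ}
    (hdoub : ∀ δ : ℝ, 0 < δ → δ ≤ δ₀ → IsDoublingAt d μ (optConst d) δ) (m : PseudoMetricSpace X)
    {a b β s : ℝ} (ha : 0 < a) (hb : 0 < b) (hβ : 0 < β) (hs : 0 < s) (hsδ : s ≤ δ₀)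
    (h : ∀ x y, a * d x y ^ β ≤ m.dist x y ∧ m.dist x y ≤ b * d x y ^ β) :
    ∃ (L s' : ℝ) (K : ℝ≥0), 0 < L ∧ 0 < s' ∧ s' ≤ s ∧ (∀ x, ∃ u, IsBump d β L s s' x u) ∧
      ∀ x, μ (qball d x s) ≤ K * μ (qball d x s') := by
  rcases hd.one_le_optConst.lt_or_eq with h1 | h1
  · obtain ⟨L, s', hL, hs', hbump⟩ := exists_isBump_of_pseudoMetric hd m ha hb hβ hs h
    -- Finitely many divisions by `C_d > 1` bring `s` below `s'`, uniformly in the centre.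
    obtain ⟨j, hj⟩ := pow_unbounded_of_one_lt (s / s') h1
    obtain ⟨K, hK⟩ := IsDoublingAt.iterate h1.le hdoub hs hsδ j
    have hpow : 0 < optConst d ^ j := by positivity
    refine ⟨L, s / optConst d ^ j, K, hL, by positivity, div_le_self hs.le (one_le_pow₀ h1.le),
      fun x => ?_, hK⟩
    obtain ⟨u, hu⟩ := hbump x
    refine ⟨u, hu.mono ?_⟩
    rw [div_le_iff₀ hpow]
    rw [div_lt_iff₀ hs'] at hj
    linarith
  · obtain ⟨L, hL, hbump⟩ := exists_isBump_of_optConst_eq_one hd h1.symm hβ hs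
    exact ⟨L, s, 1, hL, hs, le_rfl, hbump, fun x => by simp⟩

/-! ### Norms of functions with a separable gradient -/

theorem seqNorm_mul_const {q : ℝ≥0∞} (hq : 0 < q) (w : ℤ → ℝ≥0∞) (c : ℝ≥0∞) :
    seqNorm q (fun k => w k * c) = seqNorm q w * c := by
  unfold seqNorm
  split_ifs with h
  · rw [ENNReal.iSup_mul]
  · have hq' : 0 < q.toReal := ENNReal.toReal_pos hq.ne' h
    simp_rw [ENNReal.mul_rpow_of_nonneg _ _ hq'.le]
    rw [ENNReal.tsum_mul_right, ENNReal.mul_rpow_of_nonneg _ _ (by positivity), ← ENNReal.rpow_mul,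
      mul_one_div_cancel hq'.ne', ENNReal.rpow_one]

theorem intNorm_const_mul {X : Type*} [MeasurableSpace X] {μ : Measure X} {p : ℝ} (hp : 0 < p)
    (c : ℝ≥0∞) {h : X → ℝ≥0∞} (hh : Measurable h) :
    intNorm μ p (fun x => c * h x) = c * intNorm μ p h := by
  unfold intNorm
  simp_rw [ENNReal.mul_rpow_of_nonneg _ _ hp.le]
  rw [lintegral_const_mul _ (hh.pow_const p), ENNReal.mul_rpow_of_nonneg _ _ (by positivity),
    ← ENNReal.rpow_mul, mul_one_div_cancel hp.ne', ENNReal.rpow_one]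

/-- For gradients `w k * h x` the `ℓ^q` and `L^p` norms decouple, so both semi-norms get the same
bound. -/
theorem homTriebelLizorkin_le {X : Type*} [MeasurableSpace X] {d : X → X → ℝ} {μ : Measure X}
    {α p : ℝ} {q : ℝ≥0∞} (hp : 0 < p) (hq : 0 < q) {u : X → ℝ} {w : ℤ → ℝ≥0∞} {h : X → ℝ≥0∞}
    (hh : Measurable h) (hg : (fun k x => w k * h x) ∈ fractionalGradients d μ α u) :
    homTriebelLizorkin d μ α p q u ≤ seqNorm q w * intNorm μ p h := by
  refine (iInf₂_le _ hg).trans_eq ?_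
  simp_rw [seqNorm_mul_const hq]
  exact intNorm_const_mul hp _ hh

theorem homBesov_le {X : Type*} [MeasurableSpace X] {d : X → X → ℝ} {μ : Measure X}
    {α p : ℝ} {q : ℝ≥0∞} (hp : 0 < p) (hq : 0 < q) {u : X → ℝ} {w : ℤ → ℝ≥0∞} {h : X → ℝ≥0∞}
    (hh : Measurable h) (hg : (fun k x => w k * h x) ∈ fractionalGradients d μ α u) :
    homBesov d μ α p q u ≤ seqNorm q w * intNorm μ p h := by
  refine (iInf₂_le _ hg).trans_eq ?_
  simp_rw [intNorm_const_mul hp _ hh]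
  exact seqNorm_mul_const hq _ _

theorem ofReal_toReal_rpow_mul_rpow {p : ℝ} {a : ℝ≥0∞} (ha : a ≠ 0) (ha' : a ≠ ∞) :
    ENNReal.ofReal (a.toReal ^ (-(1 / p))) * a ^ (1 / p) = 1 := by
  rw [← ENNReal.ofReal_rpow_of_pos (ENNReal.toReal_pos ha ha'), ENNReal.ofReal_toReal ha',
    ← ENNReal.rpow_add _ _ ha ha', neg_add_cancel, ENNReal.rpow_zero]

theorem intNorm_indicator_normalized {X : Type*} [MeasurableSpace X] {μ : Measure X} {p : ℝ}
    (hp : 0 < p) {B : Set X} (hB : MeasurableSet B) (h0 : μ B ≠ 0) (h1 : μ B ≠ ∞) :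
    intNorm μ p (B.indicator fun _ => ENNReal.ofReal ((μ B).toReal ^ (-(1 / p)))) = 1 := by
  set c := ENNReal.ofReal ((μ B).toReal ^ (-(1 / p))) with hc
  have e : (fun y => B.indicator (fun _ => c) y ^ p) = B.indicator fun _ => c ^ p := by
    ext y
    by_cases hy : y ∈ B <;> simp [hy, hp]
  rw [intNorm, e, lintegral_indicator_const hB, ENNReal.mul_rpow_of_nonneg _ _ (by positivity),
    ← ENNReal.rpow_mul, mul_one_div_cancel hp.ne', ENNReal.rpow_one]
  exact ofReal_toReal_rpow_mul_rpow h0 h1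

/-! ### Fractional gradients of bump functions -/

/-- The weights of the fractional gradient of a bump function that is Hölder continuous of order
`β ≥ α`. -/
noncomputable def bumpWeight (α β L : ℝ) (k : ℤ) : ℝ :=
  if 0 ≤ k then L * (2 : ℝ) ^ (-(k * (β - α))) else (2 : ℝ) ^ ((k + 1) * α)

theorem bumpWeight_nonneg {α β L : ℝ} (hL : 0 < L) (k : ℤ) : 0 ≤ bumpWeight α β L k := by
  unfold bumpWeight
  split_ifs <;> positivity

theorem bumpWeight_natCast (α β L : ℝ) (n : ℕ) :
    bumpWeight α β L n = L * ((2 : ℝ) ^ (-(β - α))) ^ n := by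
  rw [bumpWeight, if_pos (Int.natCast_nonneg n), ← Real.rpow_mul_natCast two_pos.le]
  congr 2
  push_cast
  ring

theorem bumpWeight_neg (α β L : ℝ) (n : ℕ) :
    bumpWeight α β L (-((n : ℤ) + 1)) = ((2 : ℝ) ^ (-α)) ^ n := by
  rw [bumpWeight, if_neg (by omega), ← Real.rpow_mul_natCast two_pos.le]
  congr 1
  push_cast
  ring

/-- The weights decay geometrically as `k → -∞` since `α > 0`, and as `k → ∞` if `β > α`. For `β =
α` they are constant for `k ≥ 0`, which only `q = ∞` tolerates. -/
theorem seqNorm_bumpWeight_lt_top {α β L : ℝ} {q : ℝ≥0∞} (hq : 0 < q) (hα : 0 < α) (hL : 0 < L)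
    (hαβ : α ≤ β) (h : q = ∞ ∨ α < β) :
    seqNorm q (fun k => ENNReal.ofReal (bumpWeight α β L k)) < ∞ := by
  unfold seqNorm
  split_ifs with hq'
  · refine (iSup_le fun k => ENNReal.ofReal_le_ofReal (?_ : _ ≤ max L 1)).trans_lt
      ENNReal.ofReal_lt_top
    obtain ⟨n, rfl | rfl⟩ : ∃ n : ℕ, k = n ∨ k = -((n : ℤ) + 1) := by
      rcases le_or_gt 0 k with hk | hk
      · exact ⟨k.toNat, .inl (by omega)⟩
      · exact ⟨(-k - 1).toNat, .inr (by omega)⟩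
    · rw [bumpWeight_natCast]
      refine le_max_of_le_left (mul_le_of_le_one_right hL.le (pow_le_one₀ (by positivity) ?_))
      exact Real.rpow_le_one_of_one_le_of_nonpos one_le_two (by linarith)
    · rw [bumpWeight_neg]
      refine le_max_of_le_right (pow_le_one₀ (by positivity) ?_)
      exact Real.rpow_le_one_of_one_le_of_nonpos one_le_two (by linarith)
  · have hαβ' := h.resolve_left hq'
    have ht : 0 < q.toReal := ENNReal.toReal_pos hq.ne' hq'
    have hgeom : ∀ γ : ℝ, 0 < γ → Summable fun n : ℕ => (((2 : ℝ) ^ (-γ)) ^ n) ^ q.toReal := by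
      intro γ hγ
      have e : ∀ n : ℕ, (((2 : ℝ) ^ (-γ)) ^ n) ^ q.toReal = (((2 : ℝ) ^ (-γ)) ^ q.toReal) ^ n :=
        fun n => Real.rpow_pow_comm (by positivity) _ _ |>.symm
      simp_rw [e]
      refine summable_geometric_of_lt_one (by positivity) (Real.rpow_lt_one (by positivity) ?_ ht)
      exact Real.rpow_lt_one_of_one_lt_of_neg one_lt_two (by linarith)
    have hsum : Summable fun k : ℤ => bumpWeight α β L k ^ q.toReal := by
      refine Summable.of_nat_of_neg_add_one ?_ ?_
      · simp_rw [bumpWeight_natCast]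
        have e : ∀ n : ℕ, (L * ((2 : ℝ) ^ (-(β - α))) ^ n) ^ q.toReal =
            L ^ q.toReal * (((2 : ℝ) ^ (-(β - α))) ^ n) ^ q.toReal :=
          fun n => Real.mul_rpow hL.le (by positivity)
        simp_rw [e]
        exact (hgeom _ (by linarith)).mul_left _
      · simp_rw [bumpWeight_neg]
        exact hgeom α hα
    refine ENNReal.rpow_lt_top_of_nonneg (by positivity) ?_
    simp_rw [ENNReal.ofReal_rpow_of_nonneg (bumpWeight_nonneg hL _) ht.le]
    exact hsum.tsum_ofReal_ne_top

/-- At small scales (`k ≥ 0`) the Hölder bound is used, with `β - α` powers to spare; at large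
scales, only `0 ≤ b ≤ 1` and the lower bound on `d y z`. -/
theorem IsBump.abs_sub_le_bumpWeight {X : Type*} {d : X → X → ℝ} {β L s s' : ℝ} {x : X}
    {b : X → ℝ} (hb : IsBump d β L s s' x b) {α : ℝ} (hα : 0 < α) (hαβ : α ≤ β) (hL : 0 < L)
    {k : ℤ} {y z : X} (h1 : (2 : ℝ) ^ (-k - 1) ≤ d y z) (h2 : d y z < (2 : ℝ) ^ (-k)) :
    |b y - b z| ≤ d y z ^ α * bumpWeight α β L k := by
  have hpos : 0 < d y z := lt_of_lt_of_le (by positivity) h1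
  unfold bumpWeight
  split_ifs with hk
  · have h3 : d y z ^ (β - α) ≤ (2 : ℝ) ^ (-(k * (β - α))) := by
      have := Real.rpow_le_rpow hpos.le h2.le (sub_nonneg.2 hαβ)
      rw [← Real.rpow_intCast, ← Real.rpow_mul two_pos.le] at this
      push_cast at this
      rwa [neg_mul] at this
    calc |b y - b z| ≤ L * d y z ^ β := hb.holder y z
      _ = d y z ^ α * (L * d y z ^ (β - α)) := by
        rw [mul_left_comm, ← Real.rpow_add hpos, add_sub_cancel]
      _ ≤ _ := by gcongr
  · have h3 : (2 : ℝ) ^ (-((k + 1) * α)) ≤ d y z ^ α := by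
      have := Real.rpow_le_rpow (by positivity) h1 hα.le
      rw [← Real.rpow_intCast, ← Real.rpow_mul two_pos.le] at this
      push_cast at this
      convert this using 2
      ring
    calc |b y - b z| ≤ 1 := by
          rw [abs_le]
          constructor <;> linarith [hb.nonneg y, hb.nonneg z, hb.le_one y, hb.le_one z]
      _ = (2 : ℝ) ^ (-((k + 1) * α)) * (2 : ℝ) ^ ((k + 1) * α) := by
        rw [← Real.rpow_add two_pos, neg_add_cancel, Real.rpow_zero]
      _ ≤ _ := by gcongr

theorem IsBump.mem_fractionalGradients {X : Type*} [MeasurableSpace X] {d : X → X → ℝ}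
    {μ : Measure X} {β L s s' : ℝ} {x : X} {b : X → ℝ} (hb : IsBump d β L s s' x b) {α : ℝ}
    (hα : 0 < α) (hαβ : α ≤ β) (hL : 0 < L) (hs : MeasurableSet (qball d x s)) {A : ℝ}
    (hA : 0 ≤ A) :
    (fun k y => ENNReal.ofReal (bumpWeight α β L k) *
      (qball d x s).indicator (fun _ => ENNReal.ofReal A) y) ∈
        fractionalGradients d μ α (fun y => A * b y) := by
  refine ⟨fun k => (measurable_const.indicator hs).const_mul _, ∅, MeasurableSet.empty,
    measure_empty, fun k y z _ _ h1 h2 => ?_⟩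
  have hdpos : 0 < d y z := lt_of_lt_of_le (by positivity) h1
  rw [← mul_sub, abs_mul, abs_of_nonneg hA]
  -- One endpoint in the ball already makes the sum of indicators large enough; with none, both
  -- values of the bump vanish.
  by_cases hmem : y ∈ qball d x s ∨ z ∈ qball d x s
  · have h3 : ENNReal.ofReal A ≤ (qball d x s).indicator (fun _ => ENNReal.ofReal A) y +
        (qball d x s).indicator (fun _ => ENNReal.ofReal A) z := by
      rcases hmem with h | h
      · rw [Set.indicator_of_mem h]; exact le_self_add
      · rw [Set.indicator_of_mem h]; exact le_add_self
    rw [← mul_add]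
    calc ENNReal.ofReal (A * |b y - b z|)
        ≤ ENNReal.ofReal (d y z ^ α * (bumpWeight α β L k * A)) := by
          refine ENNReal.ofReal_le_ofReal ?_
          rw [← mul_assoc, mul_comm A]
          exact mul_le_mul_of_nonneg_right (hb.abs_sub_le_bumpWeight hα hαβ hL h1 h2) hA
      _ = ENNReal.ofReal (d y z ^ α) *
          (ENNReal.ofReal (bumpWeight α β L k) * ENNReal.ofReal A) := by
          rw [ENNReal.ofReal_mul (by positivity), ENNReal.ofReal_mul (bumpWeight_nonneg hL k)]
      _ ≤ _ := by gcongr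
  · push Not at hmem
    rw [hb.eq_zero y hmem.1, hb.eq_zero z hmem.2]
    simp

/-! ### Disjointly supported sequences -/

theorem exists_separated_sequence {X : Type*} {d : X → X → ℝ} {r : ℝ}
    (h : ∀ s : Set X, s.Finite → ⋃ x ∈ s, qball d x r ≠ Set.univ) :
    ∃ x : ℕ → X, ∀ i j, i < j → r ≤ d (x i) (x j) := by
  obtain ⟨x, hx⟩ := exists_seq_of_forall_finset_exists (fun _ : X => True)
    (fun a b => r ≤ d a b) fun s _ => by
      obtain ⟨y, hy⟩ := (Set.ne_univ_iff_exists_notMem _).1 (h s s.finite_toSet)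
      refine ⟨y, trivial, fun a ha => ?_⟩
      simp only [Set.mem_iUnion, not_exists] at hy
      exact not_lt.1 (hy a ha)
  exact ⟨x, fun i j hij => hx.2 i j hij⟩

theorem IsQuasiMetric.exists_disjoint_qball {X : Type*} {d : X → X → ℝ} (hd : IsQuasiMetric d)
    {r : ℝ} (hr : 0 < r) : ∃ s₀ : ℝ, 0 < s₀ ∧ ∀ s ≤ s₀, ∀ x y, r ≤ d x y →
      Disjoint (qball d x s) (qball d y s) := by
  obtain ⟨C₀, hC₀, hsym⟩ := hd.exists_symm_const
  obtain ⟨C₁, hC₁, htri⟩ := hd.quasi_triangle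
  have hC₀' : 0 < C₀ := by linarith
  refine ⟨r / (C₁ * C₀), by positivity, fun s hs x y hxy => Set.disjoint_left.2 fun z hx hy => ?_⟩
  have hx' : d x z < s := hx
  have hy' : d y z < s := hy
  have hs0 : 0 < s := (hd.nonneg x z).trans_lt hx'
  have h1 : d z y < C₀ * s := (hsym y z).trans_lt (by gcongr)
  have h2 : d x z < C₀ * s := hx'.trans_le (le_mul_of_one_le_left hs0.le hC₀)
  have h3 : d x y < C₁ * (C₀ * s) := (htri x y z).trans_lt (by gcongr; exact max_lt h2 h1)
  rw [le_div_iff₀ (by positivity)] at hs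
  linarith

/-- A sequence in `L^p`, `p ∈ (0, ∞]`, all of whose mutual distances are bounded below has no
convergent subsequence. -/
theorem not_tendsto_of_le_eLpNorm_sub {X : Type*} [MeasurableSpace X] {μ : Measure X} {p : ℝ≥0∞}
    {u : ℕ → X → ℝ} {v : X → ℝ} {c : ℝ≥0∞} (hc : 0 < c)
    (hu : ∀ n, AEStronglyMeasurable (u n) μ) (hv : AEStronglyMeasurable v μ)
    (h : ∀ i j, i ≠ j → c ≤ eLpNorm (u i - u j) p μ) :
    ¬ Tendsto (fun n => eLpNorm (u n - v) p μ) atTop (𝓝 0) := by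
  intro hlim
  -- The factor `LpAddConst` accounts for the quasi-triangle inequality when the exponent is below
  -- `1`.
  have hlim2 : Tendsto (fun n => ENNReal.LpAddConst p *
      (eLpNorm (u n - v) p μ + eLpNorm (u (n + 1) - v) p μ)) atTop (𝓝 0) := by
    have h1 := ENNReal.Tendsto.const_mul (a := ENNReal.LpAddConst p)
      (hlim.add (hlim.comp (tendsto_add_atTop_nat 1))) (.inr (ENNReal.LpAddConst_lt_top p).ne)
    simpa using h1
  refine hc.not_ge (ge_of_tendsto' hlim2 fun n => (h n (n + 1) (by omega)).trans ?_)
  rw [← sub_sub_sub_cancel_right (u n) (u (n + 1)) v]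
  exact eLpNorm_sub_le' ((hu n).sub hv) ((hu (n + 1)).sub hv) p

theorem inv_rpow_le_ofReal_rpow_mul_rpow {p : ℝ} {a b : ℝ≥0∞} {K : ℝ≥0} (hp : 0 < p) (ha : a ≠ 0) (ha' : a ≠ ∞)
    (h : a ≤ K * b) :
    (K : ℝ≥0∞)⁻¹ ^ (1 / p) ≤ ENNReal.ofReal (a.toReal ^ (-(1 / p))) * b ^ (1 / p) := by
  have hK : K ≠ 0 := by
    rintro rfl
    simp [ha] at h
  rw [← ENNReal.ofReal_rpow_of_pos (ENNReal.toReal_pos ha ha'), ENNReal.ofReal_toReal ha',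
    ENNReal.rpow_neg, ← ENNReal.inv_rpow, ← ENNReal.mul_rpow_of_nonneg _ _ (by positivity)]
  refine ENNReal.rpow_le_rpow ?_ (by positivity)
  rw [ENNReal.inv_le_iff_le_mul (fun _ => by simpa using hK) (by simp)]
  calc (1 : ℝ≥0∞) = a⁻¹ * a := (ENNReal.inv_mul_cancel ha ha').symm
    _ ≤ a⁻¹ * (K * b) := by gcongr
    _ = K * (a⁻¹ * b) := by ring

/-- If normalized bump functions on disjoint balls are bounded in the space attached to `S`, then
that space does not embed compactly into `L^p`. -/
theorem not_compactlyEmbedded_of_bumps {X : Type*} [MeasurableSpace X] {d : X → X → ℝ}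
    {μ : Measure X} (hX : IsQuasiMetricMeasureSpace d μ) {β L s s' p : ℝ} (hβ : 0 < β) (hL : 0 < L)
    (hs : 0 < s) (hs' : 0 < s') (hss : s' ≤ s) (hp : 0 < p) {K : ℝ≥0}
    (hK : ∀ x, μ (qball d x s) ≤ K * μ (qball d x s')) {x : ℕ → X} {b : ℕ → X → ℝ}
    (hb : ∀ n, IsBump d β L s s' (x n) (b n))
    (hdisj : ∀ i j, i ≠ j → Disjoint (qball d (x i) s) (qball d (x j) s))
    {S : (X → ℝ) → ℝ≥0∞} {W : ℝ≥0∞} (hW : W < ∞)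
    (hS : ∀ n, S (fun y => (μ (qball d (x n) s)).toReal ^ (-(1 / p)) * b n y) ≤ W) :
    ¬ CompactlyEmbedded μ p S := by
  intro hcomp
  set A : ℕ → ℝ := fun n => (μ (qball d (x n) s)).toReal ^ (-(1 / p)) with hA
  have hμ0 : ∀ n, μ (qball d (x n) s) ≠ 0 := fun n => (hX.measure_ball_pos _ _ hs).ne'
  have hμt : ∀ n, μ (qball d (x n) s) ≠ ∞ := fun n => (hX.measure_ball_lt_top _ _ hs).ne
  have hApos : ∀ n, 0 < A n := fun n =>
    Real.rpow_pos_of_pos (ENNReal.toReal_pos (hμ0 n) (hμt n)) _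
  have hp0 : ENNReal.ofReal p ≠ 0 := by simpa using hp
  have hmeas : ∀ n, Measurable fun y => A n * b n y := fun n =>
    ((hb n).measurable hX.isQuasiMetric hX.borel_le hβ hL).const_mul _
  have hnorm : ∀ n, eLpNorm (fun y => A n * b n y) (ENNReal.ofReal p) μ ≤ 1 := by
    intro n
    calc eLpNorm (fun y => A n * b n y) (ENNReal.ofReal p) μ
        ≤ eLpNorm ((qball d (x n) s).indicator fun _ => A n) (ENNReal.ofReal p) μ := by
          refine eLpNorm_mono fun y => ?_
          by_cases hy : y ∈ qball d (x n) s
          · rw [Set.indicator_of_mem hy, norm_mul]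
            refine mul_le_of_le_one_right (norm_nonneg _) ?_
            rw [Real.norm_of_nonneg ((hb n).nonneg y)]
            exact (hb n).le_one y
          · simp [(hb n).eq_zero y hy]
      _ = 1 := by
          rw [eLpNorm_indicator_const (hX.measurableSet_ball _ _ hs) hp0 ENNReal.ofReal_ne_top,
            Real.enorm_of_nonneg (hApos n).le, ENNReal.toReal_ofReal hp.le]
          exact ofReal_toReal_rpow_mul_rpow (hμ0 n) (hμt n)
  have hmem : ∀ n, MemLp (fun y => A n * b n y) (ENNReal.ofReal p) μ := fun n =>
    ⟨(hmeas n).aestronglyMeasurable, (hnorm n).trans_lt ENNReal.one_lt_top⟩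
  obtain ⟨v, φ, hv, hφ, hlim⟩ := hcomp (fun n y => A n * b n y)
    (fun n => ⟨hmeas n, hmem n, (hS n).trans_lt hW⟩)
    ⟨1 + W.toNNReal, fun n => by
      rw [ENNReal.coe_add, ENNReal.coe_one, ENNReal.coe_toNNReal hW.ne]
      exact add_le_add (hnorm n) (hS n)⟩
  refine not_tendsto_of_le_eLpNorm_sub (c := (K : ℝ≥0∞)⁻¹ ^ (1 / p))
    (ENNReal.rpow_pos (by simp) (by
      rw [ne_eq, ENNReal.inv_eq_top, ENNReal.coe_eq_zero]
      rintro rfl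
      exact hμ0 0 (by simpa using hK (x 0))))
    (fun n => (hmem (φ n)).1) hv.1 (fun i j hij => ?_) hlim
  have hne : φ i ≠ φ j := hφ.injective.ne hij
  have hsub : qball d (x (φ i)) s' ⊆ qball d (x (φ i)) s := fun y (hy : d _ y < s') =>
    hy.trans_le hss
  calc (K : ℝ≥0∞)⁻¹ ^ (1 / p)
      ≤ ENNReal.ofReal (A (φ i)) * μ (qball d (x (φ i)) s') ^ (1 / p) :=
        inv_rpow_le_ofReal_rpow_mul_rpow hp (hμ0 _) (hμt _) (hK _)
    _ = eLpNorm ((qball d (x (φ i)) s').indicator fun _ => A (φ i)) (ENNReal.ofReal p) μ := by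
        rw [eLpNorm_indicator_const (hX.measurableSet_ball _ _ hs') hp0 ENNReal.ofReal_ne_top,
          Real.enorm_of_nonneg (hApos _).le, ENNReal.toReal_ofReal hp.le]
    _ ≤ _ := by
        -- On the `s'`-ball of `x (φ i)` the first function equals `A (φ i)` and, by disjointness,
        -- the second vanishes.
        refine eLpNorm_mono fun y => ?_
        by_cases hy : y ∈ qball d (x (φ i)) s'
        · have h0 := (hb (φ j)).eq_zero y (Set.disjoint_left.1 (hdisj _ _ hne) (hsub hy))
          simp [hy, (hb (φ i)).eq_one y hy, h0]
        · rw [Set.indicator_of_notMem hy, norm_zero]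
          exact norm_nonneg _

end HajlaszEmbedding

theorem mainTheorem4 {X : Type*} [Nontrivial X] [MeasurableSpace X] (d : X → X → ℝ)
    (μ : MeasureTheory.Measure X) (hX : HajlaszEmbedding.IsQuasiMetricMeasureSpace d μ)
    (hdoub : ∃ δ₀ : ℝ, 0 < δ₀ ∧ ∀ δ : ℝ, 0 < δ → δ ≤ δ₀ →
      HajlaszEmbedding.IsDoublingAt d μ (HajlaszEmbedding.optConst d) δ)
    (α p : ℝ) (hα : 0 < α) (hp : 0 < p) (q : ℝ≥0∞) (hq : 0 < q)
    (hind : HajlaszEmbedding.PrecIndex α q d)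
    (hcompact : HajlaszEmbedding.TriebelLizorkinCompact d μ α p q ∨
      HajlaszEmbedding.BesovCompact d μ α p q) :
    HajlaszEmbedding.IsTotallyBounded d := by
  open HajlaszEmbedding in
  by_contra hnot
  simp only [IsTotallyBounded, not_forall, not_exists, not_and] at hnot
  obtain ⟨r, hr, hcover⟩ := hnot
  have hd := hX.isQuasiMetric
  obtain ⟨δ₀, hδ₀, hdoub⟩ := hdoub
  obtain ⟨β, hαβ, hβq, m, a, b, ha, hb, hm⟩ := hind.exists_pseudoMetric hd hα
  have hβ : 0 < β := hα.trans_le hαβ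
  obtain ⟨x, hx⟩ := exists_separated_sequence hcover
  obtain ⟨s₀, hs₀, hdisj⟩ := hd.exists_disjoint_qball hr
  -- `s₀` gives disjointness of the balls, `δ₀` the range of the doubling condition.
  set s := min s₀ δ₀
  have hs : 0 < s := lt_min hs₀ hδ₀
  obtain ⟨L, s', K, hL, hs', hss, hbump, hK⟩ :=
    exists_isBump_of_doubling hd hdoub m ha hb hβ hs (min_le_right _ _) hm
  choose u hu using fun n => hbump (x n)
  have hdisj' : ∀ i j, i ≠ j → Disjoint (qball d (x i) s) (qball d (x j) s) := by
    intro i j hij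
    rcases hij.lt_or_gt with h | h
    · exact hdisj s (min_le_left _ _) _ _ (hx i j h)
    · exact (hdisj s (min_le_left _ _) _ _ (hx j i h)).symm
  have hgrad := fun n => (hu n).mem_fractionalGradients (μ := μ) hα hαβ hL
    (hX.measurableSet_ball (x n) s hs) (A := (μ (qball d (x n) s)).toReal ^ (-(1 / p)))
    (by positivity)
  have hmeas : ∀ n, Measurable ((qball d (x n) s).indicator fun _ =>
      ENNReal.ofReal ((μ (qball d (x n) s)).toReal ^ (-(1 / p)))) := fun n =>
    measurable_const.indicator (hX.measurableSet_ball (x n) s hs)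
  have hint := fun n => intNorm_indicator_normalized hp (hX.measurableSet_ball (x n) s hs)
    (hX.measure_ball_pos (x n) s hs).ne' (hX.measure_ball_lt_top (x n) s hs).ne
  have hW := seqNorm_bumpWeight_lt_top hq hα hL hαβ hβq
  rcases hcompact with h | h
  · refine not_compactlyEmbedded_of_bumps hX hβ hL hs hs' hss hp hK hu hdisj' hW (fun n => ?_) h
    simpa only [hint, mul_one] using homTriebelLizorkin_le hp hq (hmeas n) (hgrad n)
  · refine not_compactlyEmbedded_of_bumps hX hβ hL hs hs' hss hp hK hu hdisj' hW (fun n => ?_) h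
    simpa only [hint, mul_one] using homBesov_le hp hq (hmeas n) (hgrad n)
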